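/- There is a universal constant $C>0$ such that the following holds. Let $n\ge 1$, let $\alpha>0$, and let $K\subset\mathbb{R}^n$ be a centrally-symmetric convex body (that is, a convex compact set with non-empty interior and $K=-K$) of volume $1$. Let $\|\cdot\|_K$ be the norm on $\mathbb{R}^n$ whose unit ball is $K$, and suppose that $K$ is $2$-convex with constant $\alpha$, that is, for all $0<\varepsilon\le 2$, $$\delta_K(\varepsilon):=\inf\Big\{1-\Big\|\frac{x+y}{2}\Big\|_K \;:\; \|x\|_K,\|y\|_K\le 1,\ \|x-y\|_K\ge\varepsilon\Big\}\ \ge\ \alpha\varepsilon^2 .$$ Then $$\int_K |x|\,dx\ \le\ C\,\frac{M^*(K)}{\sqrt{\alpha}},\qquad\text{where } M^*(K)=\int_{S^{n-1}}\|\theta\|_K^*\,d\sigma(\theta),\quad \|\theta\|_K^*=\sup_{y\in K}\langle\theta,y\rangle,$$ $|\cdot|$ is the Euclidean norm and $\sigma$ is the rotation-invariant probability measure on the Euclidean unit sphere $S^{n-1}$. -/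

import Mathlib

open MeasureTheory Metric

noncomputable section

namespace TwoConvexBody

variable {n : ℕ}

/-- The modulus of convexity
`δ_K(ε) = inf {1 - ‖(x+y)/2‖_K ; ‖x‖_K, ‖y‖_K ≤ 1, ‖x-y‖_K ≥ ε}` of a centrally-symmetric
convex body `K` with non-empty interior. The norm `‖·‖_K` whose unit ball is `K` is the
Minkowski functional `gauge K`. It is used for `0 < ε ≤ 2`. -/
def modulusOfConvexity (K : ConvexBody (EuclideanSpace ℝ (Fin n))) (ε : ℝ) : ℝ :=
  sInf {d : ℝ | ∃ x y : EuclideanSpace ℝ (Fin n),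
    gauge (K : Set (EuclideanSpace ℝ (Fin n))) x ≤ 1 ∧
    gauge (K : Set (EuclideanSpace ℝ (Fin n))) y ≤ 1 ∧
    ε ≤ gauge (K : Set (EuclideanSpace ℝ (Fin n))) (x - y) ∧
    d = 1 - gauge (K : Set (EuclideanSpace ℝ (Fin n))) ((1 / 2 : ℝ) • (x + y))}

/-- `K` is `2`-convex with constant `α`: `δ_K(ε) ≥ α ε²` for all `0 < ε ≤ 2`. -/
def IsTwoConvex (K : ConvexBody (EuclideanSpace ℝ (Fin n))) (α : ℝ) : Prop :=
  ∀ ε : ℝ, 0 < ε → ε ≤ 2 → α * ε ^ 2 ≤ modulusOfConvexity K ε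

/-- The dual norm `‖θ‖_K^* = sup_{y ∈ K} ⟨θ, y⟩`. -/
def dualNorm (K : ConvexBody (EuclideanSpace ℝ (Fin n))) (θ : EuclideanSpace ℝ (Fin n)) : ℝ :=
  sSup ((fun y => inner ℝ θ y) '' (K : Set (EuclideanSpace ℝ (Fin n))))

/-- The rotation-invariant probability measure on the Euclidean unit sphere `S^{n-1}`
(for `1 ≤ n`): the surface measure, normalized. -/
def sphereMeasure (n : ℕ) : Measure (sphere (0 : EuclideanSpace ℝ (Fin n)) 1) :=
  ((volume : Measure (EuclideanSpace ℝ (Fin n))).toSphere Set.univ)⁻¹ •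
    (volume : Measure (EuclideanSpace ℝ (Fin n))).toSphere

/-- `M^*(K) = ∫_{S^{n-1}} ‖θ‖_K^* dσ(θ)`. -/
def meanDualNorm (K : ConvexBody (EuclideanSpace ℝ (Fin n))) : ℝ :=
  ∫ θ : sphere (0 : EuclideanSpace ℝ (Fin n)) 1,
    dualNorm K (θ : EuclideanSpace ℝ (Fin n)) ∂(sphereMeasure n)

end TwoConvexBody

end

namespace TwoConvexBody

open scoped ENNReal Topology Pointwise

/-! Linear functionals on a `2`-convex body have Gaussian tails, and averaging over Gaussian
directions turns this into a bound for the Euclidean norm.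

Let h(θ) = ‖θ‖_K^*, and let A be the cap of K where ⟨θ, x⟩ ≥ t > 0. Points of A and -A are at
K-distance at least 2t/h(θ), so `2`-convexity puts their midpoints in e^(-δ)K with δ = 4αt²/h(θ)².
Since A and -A have equal volume, Brunn–Minkowski in multiplicative form gives vol A ≤ e^(-nδ)
(`IsTwoConvex.volume_inner_ge_le`). Integrating over t bounds the mean of |⟨θ, x⟩| on K by
√(π/(4αn)) h(θ).

Now integrate θ against the unnormalized Gaussian weight. By Fubini and rotation invariance the left
side becomes a multiple of ∫_K |x| dx; by polar coordinates the right side is M^*(K) times the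
Gaussian integral of |y|, which is at most √n (2π)^(n/2). This √n cancels the 1/√n of the tail
bound, so the constant is free of n (`IsTwoConvex.integral_norm_le`). -/

/-! ### Prékopa–Leindler and Brunn–Minkowski inequalities. -/

/-- One-dimensional Brunn–Minkowski inequality, in midpoint form. -/
theorem volume_add_volume_le_of_midpoint_mem {A B C : Set ℝ} (hA : MeasurableSet A)
    (hB : MeasurableSet B) (hAne : A.Nonempty) (hBne : B.Nonempty)
    (h : ∀ a ∈ A, ∀ b ∈ B, (1 / 2 : ℝ) * (a + b) ∈ C) :
    volume A + volume B ≤ 2 * volume C := by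
  have key : ∀ A' ⊆ A, ∀ B' ⊆ B, IsCompact A' → IsCompact B' → A'.Nonempty → B'.Nonempty →
      volume A' + volume B' ≤ 2 * volume C := by
    intro A' hA' B' hB' cA cB nA nB
    obtain ⟨a, ha, hmax⟩ := cA.exists_isGreatest nA
    obtain ⟨b, hb, hmin⟩ := cB.exists_isLeast nB
    -- B' is translated so that its least point falls on a, the greatest point of A'; the two sets
    -- then overlap in at most {a}. Pairing A' with b and B' with a puts a translate of half the
    -- union inside C.
    have hAB : volume (A' ∪ ((fun x => x + (b - a)) ⁻¹' B')) = volume A' + volume B' := by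
      rw [measure_union₀', measure_preimage_add_right]
      · exact cA.measurableSet.nullMeasurableSet
      · refine measure_mono_null (t := {a}) ?_ (measure_singleton a)
        rintro x ⟨hx1, hx2⟩
        have h1 : x ≤ a := hmax hx1
        have h2 : b ≤ x + (b - a) := hmin hx2
        exact le_antisymm h1 (by linarith)
    have hsub : A' ∪ ((fun x => x + (b - a)) ⁻¹' B') ⊆
        (fun x => (1 / 2 : ℝ) * x) ⁻¹' ((fun x => x + (1 / 2 : ℝ) * b) ⁻¹' C) := by
      rintro x (hx | hx)
      · have := h x (hA' hx) b (hB' hb)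
        simpa [mul_add] using this
      · have := h a (hA' ha) _ (hB' hx)
        have e : (1 / 2 : ℝ) * (a + (x + (b - a))) = 1 / 2 * x + 1 / 2 * b := by ring
        rw [e] at this
        exact this
    rw [← hAB]
    refine (measure_mono hsub).trans ?_
    rw [Real.volume_preimage_mul_left (by norm_num), measure_preimage_add_right]
    norm_num
  -- Inner regularity also ranges over empty compact sets; adjoining a point of A and of B covers
  -- them.
  have key2 : ∀ A' ⊆ A, ∀ B' ⊆ B, IsCompact A' → IsCompact B' →
      volume A' + volume B' ≤ 2 * volume C := by
    intro A' hA' B' hB' cA cB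
    obtain ⟨a, ha⟩ := hAne
    obtain ⟨b, hb⟩ := hBne
    refine le_trans ?_ (key (insert a A') (Set.insert_subset ha hA') (insert b B')
      (Set.insert_subset hb hB') (cA.insert a) (cB.insert b) (Set.insert_nonempty _ _)
      (Set.insert_nonempty _ _))
    exact add_le_add (measure_mono (Set.subset_insert _ _)) (measure_mono (Set.subset_insert _ _))
  rw [hA.measure_eq_iSup_isCompact, hB.measure_eq_iSup_isCompact]
  simp only [iSup_and']
  exact ENNReal.biSup_add_biSup_le' ⟨∅, Set.empty_subset _, isCompact_empty⟩
    ⟨∅, Set.empty_subset _, isCompact_empty⟩ fun A' hA' B' hB' =>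
      key2 A' hA'.1 B' hB'.1 hA'.2 hB'.2

/-- Layer-cake: for t < 1 the superlevel sets of f and g are nonempty and their midpoints lie in
that of h, so the set inequality applies at each height. For t ≥ 1 the former are empty. -/
theorem lintegral_add_lintegral_le_of_midpoint {f g h : ℝ → ℝ} (hf : Measurable f)
    (hg : Measurable g) (hh : Measurable h) (hf0 : ∀ x, 0 ≤ f x) (hg0 : ∀ x, 0 ≤ g x)
    (hh0 : ∀ x, 0 ≤ h x) (hf1 : ∀ x, f x ≤ 1) (hg1 : ∀ x, g x ≤ 1)
    (hfs : ∀ t < 1, ∃ x, t < f x) (hgs : ∀ t < 1, ∃ x, t < g x)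
    (H : ∀ x y, f x * g y ≤ h ((1 / 2 : ℝ) * (x + y)) ^ 2) :
    (∫⁻ x, ENNReal.ofReal (f x)) + (∫⁻ x, ENNReal.ofReal (g x)) ≤
      2 * ∫⁻ x, ENNReal.ofReal (h x) := by
  rw [lintegral_eq_lintegral_meas_lt _ (.of_forall hf0) hf.aemeasurable,
    lintegral_eq_lintegral_meas_lt _ (.of_forall hg0) hg.aemeasurable,
    lintegral_eq_lintegral_meas_lt _ (.of_forall hh0) hh.aemeasurable]
  have hmeas : ∀ u : ℝ → ℝ, Measurable fun t : ℝ => volume {a | t < u a} := fun u =>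
    Antitone.measurable fun s t hst => measure_mono fun a ha => lt_of_le_of_lt hst ha
  rw [← lintegral_add_left (hmeas f), ← lintegral_const_mul _ (hmeas h)]
  refine setLIntegral_mono ((hmeas h).const_mul _) fun t ht => ?_
  rcases lt_or_ge t 1 with h1 | h1
  · refine volume_add_volume_le_of_midpoint_mem (measurableSet_lt measurable_const hf)
      (measurableSet_lt measurable_const hg) (hfs t h1) (hgs t h1) fun a ha b hb => ?_
    have ht : 0 < t := ht
    have ha : t < f a := ha
    have hb : t < g b := hb
    have : t * t < f a * g b := mul_lt_mul'' ha hb ht.le ht.le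
    exact lt_of_pow_lt_pow_left₀ 2 (hh0 _) (by nlinarith [H a b])
  · have e : ∀ u : ℝ → ℝ, (∀ x, u x ≤ 1) → {a | t < u a} = ∅ := fun u hu =>
      Set.eq_empty_of_forall_notMem fun a ha => absurd (lt_of_lt_of_le ha (hu a)) (not_lt.2 h1)
    rw [e f hf1, e g hg1]
    simp

theorem four_mul_le_sq_add (x y : ℝ≥0∞) : 4 * (x * y) ≤ (x + y) ^ 2 := by
  rcases eq_or_ne x ⊤ with rfl | hx
  · simp
  rcases eq_or_ne y ⊤ with rfl | hy
  · simp
  lift x to NNReal using hx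
  lift y to NNReal using hy
  norm_cast
  rw [← NNReal.coe_le_coe]
  push_cast
  nlinarith [sq_nonneg ((x : ℝ) - y)]

/-- Dividing f and g by their suprema, and h by the geometric mean of these, reduces to the additive
inequality; AM-GM then makes it multiplicative. -/
theorem prekopaLeindler_real_of_bounded {f g h : ℝ → ℝ} (hf : Measurable f)
    (hg : Measurable g) (hh : Measurable h) (hf0 : ∀ x, 0 ≤ f x) (hg0 : ∀ x, 0 ≤ g x)
    (hh0 : ∀ x, 0 ≤ h x) (hfb : BddAbove (Set.range f)) (hgb : BddAbove (Set.range g))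
    (H : ∀ x y, f x * g y ≤ h ((1 / 2 : ℝ) * (x + y)) ^ 2) :
    (∫⁻ x, ENNReal.ofReal (f x)) * (∫⁻ x, ENNReal.ofReal (g x)) ≤
      (∫⁻ x, ENNReal.ofReal (h x)) ^ 2 := by
  set a := ⨆ x, f x with ha
  set b := ⨆ x, g x with hb
  have hfa : ∀ x, f x ≤ a := le_ciSup hfb
  have hgb' : ∀ x, g x ≤ b := le_ciSup hgb
  rcases (((hf0 0).trans (hfa 0)).eq_or_lt) with ha0 | ha0
  · have : ∀ x, f x = 0 := fun x => le_antisymm ((hfa x).trans ha0.ge) (hf0 x)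
    simp [this]
  rcases (((hg0 0).trans (hgb' 0)).eq_or_lt) with hb0 | hb0
  · have : ∀ x, g x = 0 := fun x => le_antisymm ((hgb' x).trans hb0.ge) (hg0 x)
    simp [this]
  have hs : 0 < √(a * b) := Real.sqrt_pos.2 (mul_pos ha0 hb0)
  have main := lintegral_add_lintegral_le_of_midpoint (f := fun x => f x / a)
    (g := fun x => g x / b) (h := fun x => h x / √(a * b)) (hf.div_const _) (hg.div_const _)
    (hh.div_const _) (fun x => div_nonneg (hf0 x) ha0.le) (fun x => div_nonneg (hg0 x) hb0.le)
    (fun x => div_nonneg (hh0 x) hs.le) (fun x => (div_le_one ha0).2 (hfa x))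
    (fun x => (div_le_one hb0).2 (hgb' x))
    (fun t ht => by
      obtain ⟨x, hx⟩ := exists_lt_of_lt_ciSup (show t * a < ⨆ x, f x by rw [← ha]; nlinarith)
      exact ⟨x, (lt_div_iff₀ ha0).2 hx⟩)
    (fun t ht => by
      obtain ⟨x, hx⟩ := exists_lt_of_lt_ciSup (show t * b < ⨆ x, g x by rw [← hb]; nlinarith)
      exact ⟨x, (lt_div_iff₀ hb0).2 hx⟩)
    (fun x y => by
      rw [div_pow, Real.sq_sqrt (mul_pos ha0 hb0).le, div_mul_div_comm]
      exact div_le_div_of_nonneg_right (H x y) (mul_pos ha0 hb0).le)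
  have hscale : ∀ (u : ℝ → ℝ) (c : ℝ), 0 < c → Measurable u →
      ∫⁻ x, ENNReal.ofReal (u x) =
        ENNReal.ofReal c * ∫⁻ x, ENNReal.ofReal (u x / c) := by
    intro u c hc hu
    rw [← lintegral_const_mul _ (hu.div_const c).ennreal_ofReal]
    congr with x
    rw [← ENNReal.ofReal_mul hc.le, mul_div_cancel₀ _ hc.ne']
  rw [hscale f a ha0 hf, hscale g b hb0 hg, hscale h _ hs hh]
  set F := ∫⁻ x, ENNReal.ofReal (f x / a)
  set G := ∫⁻ x, ENNReal.ofReal (g x / b)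
  set I := ∫⁻ x, ENNReal.ofReal (h x / √(a * b))
  have hFG : F * G ≤ I ^ 2 := by
    have h4 : 4 * (F * G) ≤ 4 * I ^ 2 := by
      calc 4 * (F * G) ≤ (F + G) ^ 2 := four_mul_le_sq_add F G
        _ ≤ (2 * I) ^ 2 := by gcongr
        _ = 4 * I ^ 2 := by rw [mul_pow]; norm_num
    exact (ENNReal.mul_le_mul_iff_right (by norm_num) (by norm_num)).1 h4
  rw [mul_pow, ← ENNReal.ofReal_pow hs.le, Real.sq_sqrt (mul_pos ha0 hb0).le,
    mul_mul_mul_comm, ← ENNReal.ofReal_mul ha0.le]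
  gcongr

theorem prekopaLeindler_one {f g h : ℝ → ℝ≥0∞} (hf : Measurable f)
    (hg : Measurable g) (hh : Measurable h)
    (H : ∀ x y, f x * g y ≤ h ((1 / 2 : ℝ) * (x + y)) ^ 2) :
    (∫⁻ x, f x) * (∫⁻ x, g x) ≤ (∫⁻ x, h x) ^ 2 := by
  have trunc : ∀ u : ℝ → ℝ≥0∞, Measurable u →
      ∫⁻ x, u x = ⨆ N : ℕ, ∫⁻ x, min (u x) N := by
    intro u hu
    rw [← lintegral_iSup (fun N => hu.min measurable_const)
      (fun N M hNM x => min_le_min_left _ (by exact_mod_cast hNM))]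
    congr with x
    rw [← inf_iSup_eq, ENNReal.iSup_natCast, inf_top_eq]
  have hmono : ∀ u : ℝ → ℝ≥0∞, Monotone fun N : ℕ => ∫⁻ x, min (u x) N := fun u N M hNM =>
    lintegral_mono fun x => min_le_min_left _ (by exact_mod_cast hNM)
  have step : ∀ N : ℕ, (∫⁻ x, min (f x) N) * (∫⁻ x, min (g x) N) ≤ (∫⁻ x, h x) ^ 2 := by
    intro N
    have ne : ∀ (u : ℝ → ℝ≥0∞) x, min (u x) N ≠ ⊤ := fun u x =>
      ne_top_of_le_ne_top (ENNReal.natCast_ne_top N) (min_le_right _ _)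
    have bdd : ∀ u : ℝ → ℝ≥0∞, BddAbove (Set.range fun x => (min (u x) N).toReal) := by
      intro u
      refine ⟨N, ?_⟩
      rintro _ ⟨x, rfl⟩
      exact ENNReal.toReal_le_of_le_ofReal (by positivity) (by simp)
    have := prekopaLeindler_real_of_bounded (f := fun x => (min (f x) N).toReal)
      (g := fun x => (min (g x) N).toReal) (h := fun x => (min (h x) N).toReal)
      (hf.min measurable_const).ennreal_toReal (hg.min measurable_const).ennreal_toReal
      (hh.min measurable_const).ennreal_toReal (fun _ => ENNReal.toReal_nonneg)
      (fun _ => ENNReal.toReal_nonneg) (fun _ => ENNReal.toReal_nonneg) (bdd f) (bdd g)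
      (fun x y => by
        rw [← ENNReal.toReal_mul, ← ENNReal.toReal_pow]
        refine ENNReal.toReal_mono (ENNReal.pow_ne_top (ne _ _)) ?_
        -- Truncating all three functions at the same N preserves the hypothesis.
        rcases le_total (h ((1 / 2 : ℝ) * (x + y))) N with hle | hle
        · rw [min_eq_left hle]
          exact (mul_le_mul' (min_le_left _ _) (min_le_left _ _)).trans (H x y)
        · rw [min_eq_right hle, sq]
          exact mul_le_mul' (min_le_right _ _) (min_le_right _ _))
    simp only [ENNReal.ofReal_toReal (ne _ _)] at this
    refine this.trans ?_
    gcongr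
    exact min_le_left _ _
  rw [trunc f hf, trunc g hg, ENNReal.iSup_mul]
  refine iSup_le fun N => ?_
  rw [ENNReal.mul_iSup]
  refine iSup_le fun M => ?_
  refine le_trans ?_ (step (max N M))
  exact mul_le_mul' (hmono f (le_max_left _ _)) (hmono g (le_max_right _ _))

/-- The Prékopa–Leindler inequality with weights `1/2`. -/
theorem prekopaLeindler : ∀ {n : ℕ} {f g h : (Fin n → ℝ) → ℝ≥0∞}, Measurable f →
    Measurable g → Measurable h →
    (∀ x y, f x * g y ≤ h ((1 / 2 : ℝ) • (x + y)) ^ 2) →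
    (∫⁻ x, f x) * (∫⁻ x, g x) ≤ (∫⁻ x, h x) ^ 2
  | 0, f, g, h, _, _, _, H => by
    have e : ∀ u : (Fin 0 → ℝ) → ℝ≥0∞, ∫⁻ x, u x = u 0 := fun u => by
      rw [volume_pi, Measure.pi_of_empty _ 0, lintegral_dirac]
    rw [e, e, e]
    simpa using H 0 0
  | n + 1, f, g, h, hf, hg, hh, H => by
    let e := MeasurableEquiv.piFinSuccAbove (fun _ : Fin (n + 1) => ℝ) 0
    have he : MeasurePreserving e.symm :=
      (volume_preserving_piFinSuccAbove (fun _ : Fin (n + 1) => ℝ) 0).symm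
    have fub : ∀ u : (Fin (n + 1) → ℝ) → ℝ≥0∞, Measurable u →
        ∫⁻ x, u x = ∫⁻ t : ℝ, ∫⁻ y : Fin n → ℝ, u (e.symm (t, y)) := fun u hu => by
      rw [← he.lintegral_comp hu, Measure.volume_eq_prod]
      exact lintegral_prod _ (hu.comp he.measurable).aemeasurable
    have hm : ∀ u : (Fin (n + 1) → ℝ) → ℝ≥0∞, Measurable u →
        Measurable fun t : ℝ => ∫⁻ y : Fin n → ℝ, u (e.symm (t, y)) := fun u hu =>
      (hu.comp he.measurable).lintegral_prod_right'
    rw [fub f hf, fub g hg, fub h hh]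
    -- Induction on dimension: the slices at s, t and their midpoint satisfy the hypothesis one
    -- dimension lower, so the marginals satisfy it on the line.
    refine prekopaLeindler_one (hm f hf) (hm g hg) (hm h hh) fun s t => ?_
    have hs : ∀ (u : (Fin (n + 1) → ℝ) → ℝ≥0∞) (s : ℝ), Measurable u →
        Measurable fun y : Fin n → ℝ => u (e.symm (s, y)) := fun u s hu =>
      hu.comp (he.measurable.comp measurable_prodMk_left)
    refine prekopaLeindler (hs f s hf) (hs g t hg) (hs h _ hh) fun x y => ?_
    refine (H _ _).trans_eq ?_
    congr 2
    ext i
    refine Fin.cases ?_ (fun j => ?_) i <;>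
      simp [e, MeasurableEquiv.piFinSuccAbove, Fin.insertNthEquiv, mul_add]

/-- The multiplicative Brunn–Minkowski inequality for midpoints. -/
theorem volume_mul_volume_le_of_midpoint_mem {n : ℕ} {A B C : Set (EuclideanSpace ℝ (Fin n))}
    (hA : MeasurableSet A) (hB : MeasurableSet B) (hC : MeasurableSet C)
    (h : ∀ a ∈ A, ∀ b ∈ B, (1 / 2 : ℝ) • (a + b) ∈ C) :
    volume A * volume B ≤ volume C ^ 2 := by
  have hp := PiLp.volume_preserving_toLp (Fin n)
  rw [← hp.measure_preimage hA.nullMeasurableSet, ← hp.measure_preimage hB.nullMeasurableSet,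
    ← hp.measure_preimage hC.nullMeasurableSet]
  have mA := hp.measurable hA
  have mB := hp.measurable hB
  have mC := hp.measurable hC
  rw [← lintegral_indicator_one mA, ← lintegral_indicator_one mB, ← lintegral_indicator_one mC]
  refine prekopaLeindler (measurable_one.indicator mA) (measurable_one.indicator mB)
    (measurable_one.indicator mC) fun x y => ?_
  by_cases hx : x ∈ WithLp.toLp 2 ⁻¹' A
  · by_cases hy : y ∈ WithLp.toLp 2 ⁻¹' B
    · have hz : (1 / 2 : ℝ) • (x + y) ∈ WithLp.toLp 2 ⁻¹' C := h _ hx _ hy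
      rw [Set.indicator_of_mem hz]
      simp [Set.indicator_of_mem hx, Set.indicator_of_mem hy]
    · simp [Set.indicator_of_notMem hy]
  · simp [Set.indicator_of_notMem hx]

/-! ### Gauge, dual norm and deviation of linear functionals. -/

section Body

variable {n : ℕ} {K : ConvexBody (EuclideanSpace ℝ (Fin n))}

theorem mem_nhds_zero (hint : (interior (K : Set (EuclideanSpace ℝ (Fin n)))).Nonempty)
    (hsymm : ∀ x ∈ K, -x ∈ K) : (K : Set (EuclideanSpace ℝ (Fin n))) ∈ 𝓝 0 := by
  obtain ⟨x, hx⟩ := hint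
  have hneg : -x ∈ interior (K : Set (EuclideanSpace ℝ (Fin n))) := by
    refine mem_interior.2 ⟨-interior (K : Set (EuclideanSpace ℝ (Fin n))), fun y hy => ?_,
      isOpen_interior.neg, by simpa using hx⟩
    simpa using hsymm _ (interior_subset hy)
  have := K.convex.interior hx hneg (a := 1 / 2) (b := 1 / 2) (by norm_num) (by norm_num)
    (by norm_num)
  rw [smul_neg, add_neg_cancel] at this
  exact mem_interior_iff_mem_nhds.1 this

theorem gauge_le_one_iff (h0 : (K : Set (EuclideanSpace ℝ (Fin n))) ∈ 𝓝 0)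
    (x : EuclideanSpace ℝ (Fin n)) :
    gauge (K : Set (EuclideanSpace ℝ (Fin n))) x ≤ 1 ↔ x ∈ K := by
  rw [gauge_le_one_iff_mem_closure K.convex h0, K.isClosed.closure_eq]
  rfl

theorem bddAbove_inner_image (θ : EuclideanSpace ℝ (Fin n)) :
    BddAbove ((fun y => inner ℝ θ y) '' (K : Set (EuclideanSpace ℝ (Fin n)))) :=
  (K.isCompact.image (by fun_prop)).bddAbove

theorem inner_le_dualNorm (θ : EuclideanSpace ℝ (Fin n)) {y : EuclideanSpace ℝ (Fin n)}
    (hy : y ∈ K) : inner ℝ θ y ≤ dualNorm K θ :=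
  le_csSup (bddAbove_inner_image θ) ⟨y, hy, rfl⟩

theorem abs_inner_le_dualNorm (hsymm : ∀ x ∈ K, -x ∈ K) (θ : EuclideanSpace ℝ (Fin n))
    {y : EuclideanSpace ℝ (Fin n)} (hy : y ∈ K) : |inner ℝ θ y| ≤ dualNorm K θ := by
  refine abs_le.2 ⟨?_, inner_le_dualNorm θ hy⟩
  have := inner_le_dualNorm θ (hsymm y hy)
  rw [inner_neg_right] at this
  linarith

theorem dualNorm_nonneg (hsymm : ∀ x ∈ K, -x ∈ K) (θ : EuclideanSpace ℝ (Fin n)) :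
    0 ≤ dualNorm K θ := by
  obtain ⟨y, hy⟩ := K.nonempty
  exact (abs_nonneg _).trans (abs_inner_le_dualNorm hsymm θ hy)

theorem inner_le_dualNorm_mul_gauge (h0 : (K : Set (EuclideanSpace ℝ (Fin n))) ∈ 𝓝 0)
    (θ z : EuclideanSpace ℝ (Fin n)) :
    inner ℝ θ z ≤ dualNorm K θ * gauge (K : Set (EuclideanSpace ℝ (Fin n))) z := by
  rcases (gauge_nonneg (s := (K : Set (EuclideanSpace ℝ (Fin n)))) z).eq_or_lt with hz | hz
  · have hz0 : z = 0 := (gauge_eq_zero (absorbent_nhds_zero h0)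
      (NormedSpace.isVonNBounded_of_isBounded ℝ K.isCompact.isBounded)).1 hz.symm
    simp [hz0]
  · set r := gauge (K : Set (EuclideanSpace ℝ (Fin n))) z with hr
    have hmem : r⁻¹ • z ∈ K := by
      rw [← gauge_le_one_iff h0, gauge_smul_of_nonneg (inv_nonneg.2 hz.le), ← hr, smul_eq_mul,
        inv_mul_cancel₀ hz.ne']
    have := inner_le_dualNorm θ hmem
    rw [inner_smul_right, inv_mul_le_iff₀ hz] at this
    linarith

/-- Midpoints of far-apart points of a `2`-convex body lie deep inside the body. -/
theorem IsTwoConvex.gauge_midpoint_le {α : ℝ} (hK : IsTwoConvex K α)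
    (h0 : (K : Set (EuclideanSpace ℝ (Fin n))) ∈ 𝓝 0) {x y : EuclideanSpace ℝ (Fin n)}
    (hx : x ∈ K) (hy : y ∈ K) {ε : ℝ} (hε : 0 < ε) (hε2 : ε ≤ 2)
    (hxy : ε ≤ gauge (K : Set (EuclideanSpace ℝ (Fin n))) (x - y)) :
    gauge (K : Set (EuclideanSpace ℝ (Fin n))) ((1 / 2 : ℝ) • (x + y)) ≤ 1 - α * ε ^ 2 := by
  have hle : modulusOfConvexity K ε ≤
      1 - gauge (K : Set (EuclideanSpace ℝ (Fin n))) ((1 / 2 : ℝ) • (x + y)) := by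
    -- The real `sInf` needs a lower bound; 0 is one because midpoints of K stay in K.
    refine csInf_le ⟨0, ?_⟩ ⟨x, y, (gauge_le_one_iff h0 x).2 hx, (gauge_le_one_iff h0 y).2 hy,
      hxy, rfl⟩
    rintro _ ⟨u, v, hu, hv, -, rfl⟩
    rw [gauge_le_one_iff h0] at hu hv
    have : (1 / 2 : ℝ) • (u + v) ∈ K := by
      rw [smul_add]
      exact K.convex hu hv (by norm_num) (by norm_num) (by norm_num)
    linarith [(gauge_le_one_iff h0 _).2 this]
  linarith [hK ε hε hε2]

/-- Gaussian deviation of linear functionals on a `2`-convex body. -/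
theorem IsTwoConvex.volume_inner_ge_le {α : ℝ} (hK : IsTwoConvex K α)
    (h0 : (K : Set (EuclideanSpace ℝ (Fin n))) ∈ 𝓝 0) (hsymm : ∀ x ∈ K, -x ∈ K)
    (hvol : volume (K : Set (EuclideanSpace ℝ (Fin n))) = 1)
    (θ : EuclideanSpace ℝ (Fin n)) {t : ℝ} (ht : 0 < t) :
    volume {x : EuclideanSpace ℝ (Fin n) | x ∈ K ∧ t ≤ inner ℝ θ x} ≤
      ENNReal.ofReal (Real.exp (-(4 * α * n / dualNorm K θ ^ 2) * t ^ 2)) := by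
  set A := {x : EuclideanSpace ℝ (Fin n) | x ∈ K ∧ t ≤ inner ℝ θ x} with hA
  set h := dualNorm K θ with hh
  rcases A.eq_empty_or_nonempty with hAe | ⟨x₀, hx₀⟩
  · simp [hAe]
  -- A nonempty cap forces t ≤ h, which keeps ε = 2t/h in the range ε ≤ 2 of the modulus.
  have hth : t ≤ h := hx₀.2.trans (inner_le_dualNorm θ hx₀.1)
  have hpos : 0 < h := ht.trans_le hth
  set δ := α * (2 * t / h) ^ 2 with hδ
  set C := Real.exp (-δ) • (K : Set (EuclideanSpace ℝ (Fin n))) with hC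
  have hAm : MeasurableSet A := by
    have hclosed : IsClosed {x : EuclideanSpace ℝ (Fin n) | t ≤ inner ℝ θ x} :=
      isClosed_le continuous_const (by fun_prop)
    exact K.isClosed.measurableSet.inter hclosed.measurableSet
  have hCm : MeasurableSet C := (K.isCompact.smul _).measurableSet
  have hmid : ∀ a ∈ A, ∀ b ∈ -A, (1 / 2 : ℝ) • (a + b) ∈ C := by
    rintro a ⟨haK, hat⟩ b ⟨hbK, hbt⟩
    have hbK' : b ∈ K := by simpa using hsymm _ hbK
    have hdist : 2 * t / h ≤ gauge (K : Set (EuclideanSpace ℝ (Fin n))) (a - b) := by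
      rw [div_le_iff₀' hpos]
      refine le_trans ?_ (inner_le_dualNorm_mul_gauge h0 θ (a - b))
      rw [inner_neg_right] at hbt
      rw [inner_sub_right]
      linarith
    have hg := hK.gauge_midpoint_le h0 haK hbK' (div_pos (by linarith) hpos)
      ((div_le_iff₀ hpos).2 (by linarith)) hdist
    rw [hC, Set.mem_smul_set_iff_inv_smul_mem₀ (Real.exp_pos _).ne', ← Real.exp_neg, neg_neg]
    refine (gauge_le_one_iff h0 _).1 ?_
    rw [gauge_smul_of_nonneg (Real.exp_pos _).le, smul_eq_mul]
    -- Here 1 - δ ≤ e^(-δ); the exponential keeps the dilation factor positive and makes its n-th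
    -- power explicit.
    calc Real.exp δ * _ ≤ Real.exp δ * Real.exp (-δ) := by
          gcongr
          linarith [Real.add_one_le_exp (-δ)]
      _ = 1 := by rw [← Real.exp_add]; simp
  have hbm := volume_mul_volume_le_of_midpoint_mem hAm hAm.neg hCm hmid
  rw [Measure.measure_neg, ← sq] at hbm
  have hle : volume A ≤ volume C := (ENNReal.pow_right_strictMono two_ne_zero).le_iff_le.1 hbm
  refine hle.trans_eq ?_
  rw [hC, Measure.addHaar_smul, hvol, mul_one, abs_of_pos (pow_pos (Real.exp_pos _) _),
    finrank_euclideanSpace_fin, ← Real.exp_nat_mul]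
  congr 2
  rw [hδ]
  field_simp
  ring

/-- First moment of linear functionals on a `2`-convex body. -/
theorem IsTwoConvex.integral_abs_inner_le {α : ℝ} (hK : IsTwoConvex K α) (hα : 0 < α)
    (hn : 1 ≤ n)
    (h0 : (K : Set (EuclideanSpace ℝ (Fin n))) ∈ 𝓝 0) (hsymm : ∀ x ∈ K, -x ∈ K)
    (hvol : volume (K : Set (EuclideanSpace ℝ (Fin n))) = 1)
    (θ : EuclideanSpace ℝ (Fin n)) :
    ∫ x in (K : Set (EuclideanSpace ℝ (Fin n))), |inner ℝ θ x| ≤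
      √(Real.pi / (4 * α * n)) * dualNorm K θ := by
  have hKm : MeasurableSet (K : Set (EuclideanSpace ℝ (Fin n))) := K.isClosed.measurableSet
  -- If the dual norm vanishes, so does the functional on K, and the Gaussian rate would divide by
  -- zero.
  rcases (dualNorm_nonneg hsymm θ).eq_or_lt with hh | hh
  · rw [← hh, mul_zero]
    refine setIntegral_nonpos hKm fun x hx => ?_
    rw [hh]
    exact abs_inner_le_dualNorm hsymm θ hx
  have hn0 : (0 : ℝ) < n := by exact_mod_cast hn
  set b := 4 * α * n / dualNorm K θ ^ 2 with hb
  have hb0 : 0 < b := by positivity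
  have hsqrt : √(Real.pi / b) = √(Real.pi / (4 * α * n)) * dualNorm K θ := by
    rw [hb, div_div_eq_mul_div, mul_div_right_comm, Real.sqrt_mul (by positivity),
      Real.sqrt_sq hh.le]
  rw [integral_eq_lintegral_of_nonneg_ae (.of_forall fun x => abs_nonneg _)
    (by fun_prop), ← hsqrt]
  refine ENNReal.toReal_le_of_le_ofReal (Real.sqrt_nonneg _) ?_
  rw [lintegral_eq_lintegral_meas_le _ (.of_forall fun x => abs_nonneg _) (by fun_prop)]
  -- The factor 2 counts the opposite caps A and -A.
  calc _ ≤ ∫⁻ t in Set.Ioi (0 : ℝ), ENNReal.ofReal (2 * Real.exp (-b * t ^ 2)) := by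
        refine setLIntegral_mono (by fun_prop) fun t ht => ?_
        rw [Measure.restrict_apply' hKm]
        set A := {x : EuclideanSpace ℝ (Fin n) | x ∈ K ∧ t ≤ inner ℝ θ x} with hA
        have hAle := hK.volume_inner_ge_le h0 hsymm hvol θ ht
        calc _ ≤ volume (A ∪ -A) := by
              refine measure_mono ?_
              rintro x ⟨hx, hxK⟩
              rcases le_abs.1 (Set.mem_ofPred.1 hx) with hx | hx
              · exact Or.inl ⟨hxK, hx⟩
              · exact Or.inr ⟨hsymm x hxK, by rwa [inner_neg_right]⟩
          _ ≤ volume A + volume (-A) := measure_union_le _ _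
          _ ≤ _ := by
              rw [Measure.measure_neg, ← two_mul, ENNReal.ofReal_mul (by norm_num)]
              gcongr
              simp
    _ = ENNReal.ofReal √(Real.pi / b) := by
        rw [← ofReal_integral_eq_lintegral_ofReal
          ((integrable_exp_neg_mul_sq hb0).const_mul 2).integrableOn
          (.of_forall fun t => by positivity), integral_const_mul, integral_gaussian_Ioi]
        congr 1
        ring

end Body

/-! ### Polar coordinates for homogeneous functions. -/

section Polar

variable {E : Type*} [NormedAddCommGroup E] [NormedSpace ℝ E] [FiniteDimensional ℝ E]
  [Nontrivial E] [MeasurableSpace E] [BorelSpace E]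

/-- Integration in polar coordinates of a positively homogeneous function times a radial weight. -/
theorem integral_homogeneous_mul_radial (μ : Measure E) [μ.IsAddHaarMeasure] {φ : E → ℝ}
    (hφ : ∀ r : ℝ, 0 < r → ∀ x, φ (r • x) = r * φ x) (w : ℝ → ℝ) :
    ∫ y, φ y * w ‖y‖ ∂μ = (∫ u : sphere (0 : E) 1, φ u ∂μ.toSphere) *
      ∫ r : Set.Ioi (0 : ℝ), r.1 * w r.1 ∂Measure.volumeIoiPow (Module.finrank ℝ E - 1) := by
  calc
    _ = ∫ x : ({(0)}ᶜ : Set E), φ x.1 * w ‖x.1‖ ∂(μ.comap (↑)) := by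
      rw [integral_subtype_comap (measurableSet_singleton _).compl fun x ↦ φ x * w ‖x‖,
        restrict_compl_singleton]
    _ = ∫ p : sphere (0 : E) 1 × Set.Ioi (0 : ℝ), φ p.1 * (p.2.1 * w p.2.1)
          ∂μ.toSphere.prod (.volumeIoiPow (Module.finrank ℝ E - 1)) := by
      rw [← μ.measurePreserving_homeomorphUnitSphereProd.integral_comp
        (Homeomorph.measurableEmbedding _)]
      refine integral_congr_ae (.of_forall fun x => ?_)
      have hx : 0 < ‖x.1‖ := norm_pos_iff.2 x.2
      simp only [homeomorphUnitSphereProd_apply_snd_coe, homeomorphUnitSphereProd_apply_fst_coe]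
      rw [hφ _ (inv_pos.2 hx)]
      field_simp
    _ = _ := integral_prod_mul (fun u : sphere (0 : E) 1 => φ u)
      (fun r : Set.Ioi (0 : ℝ) => r.1 * w r.1)

/-- The polar formula for φ and for the norm has the same radial factor, so it need not be computed.
-/
theorem integral_homogeneous_mul_radial_eq_average (μ : Measure E) [μ.IsAddHaarMeasure] {φ : E → ℝ}
    (hφ : ∀ r : ℝ, 0 < r → ∀ x, φ (r • x) = r * φ x) (w : ℝ → ℝ) :
    ∫ y, φ y * w ‖y‖ ∂μ =
      (∫ u : sphere (0 : E) 1, φ u ∂((μ.toSphere Set.univ)⁻¹ • μ.toSphere)) *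
        ∫ y, ‖y‖ * w ‖y‖ ∂μ := by
  rw [integral_homogeneous_mul_radial μ hφ w,
    integral_homogeneous_mul_radial μ (φ := fun y => ‖y‖)
      (fun r hr x => by rw [norm_smul, Real.norm_of_nonneg hr.le]) w, integral_smul_measure]
  have h0 : μ.toSphere.real Set.univ ≠ 0 := by
    rw [measureReal_def, ENNReal.toReal_ne_zero]
    exact ⟨Measure.measure_univ_ne_zero.2 μ.toSphere_ne_zero, measure_ne_top _ _⟩
  simp only [norm_eq_of_mem_sphere, integral_const, smul_eq_mul, mul_one, ENNReal.toReal_inv]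
  rw [← measureReal_def]
  field_simp

end Polar

/-! ### Gaussian integrals. -/

section Gaussian

theorem integral_abs_mul_exp : ∫ t : ℝ, |t| * Real.exp (-(1 / 2) * t ^ 2) = 2 := by
  have habs := integral_comp_abs (f := fun s : ℝ => s * Real.exp (-(1 / 2) * s ^ 2))
  simp only [sq_abs] at habs
  rw [habs]
  have := integral_rpow_mul_exp_neg_mul_rpow (p := 2) (q := 1) (b := 1 / 2) (by norm_num)
    (by norm_num) (by norm_num)
  norm_num [Real.rpow_neg_one] at this ⊢
  rw [this]

theorem integral_sq_mul_exp :
    ∫ t : ℝ, t ^ 2 * Real.exp (-(1 / 2) * t ^ 2) = √(2 * Real.pi) := by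
  have habs := integral_comp_abs (f := fun s : ℝ => s ^ 2 * Real.exp (-(1 / 2) * s ^ 2))
  simp only [sq_abs] at habs
  rw [habs]
  have := integral_rpow_mul_exp_neg_mul_rpow (p := 2) (q := 2) (b := 1 / 2) (by norm_num)
    (by norm_num) (by norm_num)
  have hG : Real.Gamma ((2 + 1) / 2) = 1 / 2 * √Real.pi := by
    rw [← Real.Gamma_one_half_eq, ← Real.Gamma_add_one (by norm_num)]
    norm_num
  have hp : (1 / 2 : ℝ) ^ (-(2 + 1) / 2 : ℝ) = 2 * √2 := by
    rw [one_div, Real.inv_rpow (by norm_num), ← Real.rpow_neg (by norm_num), Real.sqrt_eq_rpow,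
      show (-(-(2 + 1) / 2) : ℝ) = 1 + 1 / 2 by norm_num, Real.rpow_add (by norm_num),
      Real.rpow_one]
  rw [hG, hp] at this
  simp only [Real.rpow_ofNat] at this
  rw [this, Real.sqrt_mul (by norm_num)]
  ring

variable {n : ℕ}

/-- The Gaussian weight is a product over coordinates; the n - 1 coordinates other than i each
contribute √(2π). -/
theorem integral_coord_mul_exp (i : Fin n) (g : ℝ → ℝ) :
    ∫ y : EuclideanSpace ℝ (Fin n), g (y i) * Real.exp (-(1 / 2) * ‖y‖ ^ 2) =
      (∫ t : ℝ, g t * Real.exp (-(1 / 2) * t ^ 2)) * √(2 * Real.pi) ^ (n - 1) := by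
  have hp := PiLp.volume_preserving_toLp (Fin n)
  rw [← hp.integral_comp (MeasurableEquiv.toLp 2 (Fin n → ℝ)).measurableEmbedding]
  have hprod : ∀ y : Fin n → ℝ,
      g (WithLp.toLp 2 y i) * Real.exp (-(1 / 2) * ‖WithLp.toLp 2 y‖ ^ 2) =
        ∏ j, ((if j = i then g (y j) else 1) * Real.exp (-(1 / 2) * y j ^ 2)) := by
    intro y
    rw [Finset.prod_mul_distrib, Finset.prod_ite_eq' Finset.univ i fun j => g (y j),
      if_pos (Finset.mem_univ i), EuclideanSpace.norm_sq_eq, ← Real.exp_sum, Finset.mul_sum]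
    simp
  simp_rw [hprod]
  rw [integral_fintype_prod_volume_eq_prod
    (fun j t => (if j = i then g t else 1) * Real.exp (-(1 / 2) * t ^ 2)),
    Fintype.prod_eq_mul_prod_compl i]
  congr 1
  · simp
  · rw [Finset.prod_congr rfl (g := fun _ => √(2 * Real.pi))]
    · simp [Finset.card_compl]
    · intro j hj
      have hj : j ≠ i := by simpa using hj
      simp only [if_neg hj, one_mul]
      rw [integral_gaussian]
      congr 1
      ring

theorem integrable_norm_pow_mul_exp [NeZero n] (k : ℕ) :
    Integrable fun y : EuclideanSpace ℝ (Fin n) => ‖y‖ ^ k * Real.exp (-(1 / 2) * ‖y‖ ^ 2) := by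
  rw [integrable_fun_norm_addHaar volume (f := fun t : ℝ => t ^ k * Real.exp (-(1 / 2) * t ^ 2))]
  have := integrableOn_rpow_mul_exp_neg_mul_sq (b := 1 / 2) (by norm_num)
    (s := ((Module.finrank ℝ (EuclideanSpace ℝ (Fin n)) - 1 + k : ℕ) : ℝ))
    (lt_of_lt_of_le (by norm_num) (Nat.cast_nonneg _))
  simp only [Real.rpow_natCast, pow_add, mul_assoc] at this
  exact this

theorem integral_abs_inner_mul_exp [NeZero n] (x : EuclideanSpace ℝ (Fin n)) :
    ∫ y : EuclideanSpace ℝ (Fin n), |inner ℝ y x| * Real.exp (-(1 / 2) * ‖y‖ ^ 2) =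
      ‖x‖ * (2 * √(2 * Real.pi) ^ (n - 1)) := by
  rcases eq_or_ne x 0 with rfl | hx
  · simp
  have hx0 : ‖x‖ ≠ 0 := norm_ne_zero_iff.2 hx
  set u := ‖x‖⁻¹ • x with hu
  have hu1 : ‖u‖ = 1 := by rw [hu, norm_smul, norm_inv, norm_norm, inv_mul_cancel₀ hx0]
  -- Rotation invariance: in an orthonormal basis starting with x/‖x‖, the functional is ‖x‖ times a
  -- coordinate.
  obtain ⟨b, hb⟩ := Orthonormal.exists_orthonormalBasis_extension_of_card_eq (𝕜 := ℝ)
    (E := EuclideanSpace ℝ (Fin n)) (ι := Fin n) (by simp) (v := fun _ => u)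
    (s := {(0 : Fin n)}) ⟨fun _ => hu1, fun i j hij => (hij (Subsingleton.elim _ _)).elim⟩
  have hb0 : b 0 = u := hb 0 rfl
  have hin : ∀ y, |inner ℝ y x| * Real.exp (-(1 / 2) * ‖y‖ ^ 2) =
      ‖x‖ * (|b.repr y 0| * Real.exp (-(1 / 2) * ‖b.repr y‖ ^ 2)) := by
    intro y
    rw [LinearIsometryEquiv.norm_map, OrthonormalBasis.repr_apply_apply, hb0, hu,
      real_inner_smul_left, abs_mul, abs_of_nonneg (inv_nonneg.2 (norm_nonneg x)),
      real_inner_comm, ← mul_assoc, ← mul_assoc, mul_inv_cancel₀ hx0, one_mul]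
  simp_rw [hin]
  rw [integral_const_mul, b.repr.measurePreserving.integral_comp
    b.repr.toHomeomorph.measurableEmbedding
    (fun z : EuclideanSpace ℝ (Fin n) => |z 0| * Real.exp (-(1 / 2) * ‖z‖ ^ 2)),
    integral_coord_mul_exp 0 fun t => |t|, integral_abs_mul_exp]

theorem integral_norm_mul_exp_le [NeZero n] :
    ∫ y : EuclideanSpace ℝ (Fin n), ‖y‖ * Real.exp (-(1 / 2) * ‖y‖ ^ 2) ≤
      √n * √(2 * Real.pi) ^ n := by
  set z := √(2 * Real.pi) with hz
  have hn : (0 : ℝ) < n := Nat.cast_pos.2 (NeZero.pos n)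
  have hs : 0 < √(n : ℝ) := Real.sqrt_pos.2 hn
  have hzn : z * z ^ (n - 1) = z ^ n := mul_pow_sub_one (NeZero.ne n) z
  have i0 := integrable_norm_pow_mul_exp (n := n) 0
  have i1 := integrable_norm_pow_mul_exp (n := n) 1
  have i2 := integrable_norm_pow_mul_exp (n := n) 2
  simp only [pow_zero, pow_one, one_mul] at i0 i1
  have h0 : ∫ y : EuclideanSpace ℝ (Fin n), Real.exp (-(1 / 2) * ‖y‖ ^ 2) = z ^ n := by
    have := integral_coord_mul_exp (0 : Fin n) fun _ => 1
    simp only [one_mul] at this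
    rw [this, integral_gaussian, ← hzn, hz]
    congr 2
    ring_nf
  have h2 : ∫ y : EuclideanSpace ℝ (Fin n), ‖y‖ ^ 2 * Real.exp (-(1 / 2) * ‖y‖ ^ 2) =
      n * z ^ n := by
    have hint : ∀ i ∈ Finset.univ, Integrable fun y : EuclideanSpace ℝ (Fin n) =>
        y i ^ 2 * Real.exp (-(1 / 2) * ‖y‖ ^ 2) := fun i _ => by
      refine i2.mono' (by fun_prop) (.of_forall fun y => ?_)
      rw [Real.norm_of_nonneg (by positivity)]
      gcongr ?_ * _
      rw [sq_le_sq, abs_norm]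
      exact PiLp.norm_apply_le y i
    have hsum : ∀ y : EuclideanSpace ℝ (Fin n), ‖y‖ ^ 2 * Real.exp (-(1 / 2) * ‖y‖ ^ 2) =
        ∑ i, y i ^ 2 * Real.exp (-(1 / 2) * ‖y‖ ^ 2) := fun y => by
      rw [← Finset.sum_mul, ← EuclideanSpace.real_norm_sq_eq]
    simp_rw [hsum]
    rw [integral_finsetSum _ hint]
    simp_rw [integral_coord_mul_exp _ fun t => t ^ 2, integral_sq_mul_exp]
    rw [← hz, hzn]
    simp
  calc _ ≤ ∫ y : EuclideanSpace ℝ (Fin n),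
        ((1 / (2 * √n)) * (‖y‖ ^ 2 * Real.exp (-(1 / 2) * ‖y‖ ^ 2)) +
          (√n / 2) * Real.exp (-(1 / 2) * ‖y‖ ^ 2)) := by
        refine integral_mono i1 ((i2.const_mul _).add (i0.const_mul _)) fun y => ?_
        -- AM-GM with equality at ‖y‖ = √n replaces Cauchy–Schwarz; the second moment is n times the
        -- total mass.
        have : ‖y‖ ≤ 1 / (2 * √n) * ‖y‖ ^ 2 + √n / 2 := by
          have : 1 / (2 * √n) * ‖y‖ ^ 2 + √n / 2 - ‖y‖ = (‖y‖ - √n) ^ 2 / (2 * √n) := by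
            field_simp
            ring
          have h' : 0 ≤ (‖y‖ - √n) ^ 2 / (2 * √n) := by positivity
          linarith
        calc _ ≤ (1 / (2 * √n) * ‖y‖ ^ 2 + √n / 2) * Real.exp (-(1 / 2) * ‖y‖ ^ 2) := by
              gcongr
          _ = _ := by ring
    _ = _ := by
        rw [integral_add (i2.const_mul _) (i0.const_mul _), integral_const_mul,
          integral_const_mul, h0, h2]
        have : (n : ℝ) = √n * √n := (Real.mul_self_sqrt hn.le).symm
        field_simp
        rw [Real.sq_sqrt hn.le]
        ring

end Gaussian

/-! ### Averaging over Gaussian directions. -/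

section Body

variable {n : ℕ} {K : ConvexBody (EuclideanSpace ℝ (Fin n))}

theorem dualNorm_smul {r : ℝ} (hr : 0 < r) (θ : EuclideanSpace ℝ (Fin n)) :
    dualNorm K (r • θ) = r * dualNorm K θ := by
  unfold dualNorm
  rw [← smul_eq_mul, ← Real.sSup_smul_of_nonneg hr.le, ← Set.image_smul, Set.image_image]
  simp [real_inner_smul_left]

/-- Boundedness of K gives the constant; this supplies continuity and linear growth for Gaussian
integrability. -/
theorem exists_lipschitzWith_dualNorm (K : ConvexBody (EuclideanSpace ℝ (Fin n))) :
    ∃ R, LipschitzWith R (dualNorm K) := by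
  obtain ⟨R, hR0, hR⟩ := K.isCompact.isBounded.exists_pos_norm_le
  refine ⟨R.toNNReal, .of_le_add_mul _ fun x y => ?_⟩
  refine csSup_le (K.nonempty.image _) ?_
  rintro _ ⟨v, hv, rfl⟩
  have h1 : inner ℝ x v = inner ℝ y v + inner ℝ (x - y) v := by
    rw [← inner_add_left]
    simp
  have h2 : inner ℝ (x - y) v ≤ ‖x - y‖ * ‖v‖ := real_inner_le_norm _ _
  have h3 : ‖x - y‖ * ‖v‖ ≤ ‖x - y‖ * R := by
    gcongr
    exact hR v hv
  have h4 := inner_le_dualNorm y hv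
  rw [Real.coe_toNNReal R hR0.le, dist_eq_norm]
  linarith

theorem integral_dualNorm_mul_exp [NeZero n] :
    ∫ y, dualNorm K y * Real.exp (-(1 / 2) * ‖y‖ ^ 2) =
      meanDualNorm K *
        ∫ y : EuclideanSpace ℝ (Fin n), ‖y‖ * Real.exp (-(1 / 2) * ‖y‖ ^ 2) :=
  integral_homogeneous_mul_radial_eq_average volume (fun _ hr x => dualNorm_smul hr x)
    fun r => Real.exp (-(1 / 2) * r ^ 2)

theorem integrable_dualNorm_mul_exp [NeZero n] (hsymm : ∀ x ∈ K, -x ∈ K) :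
    Integrable fun y => dualNorm K y * Real.exp (-(1 / 2) * ‖y‖ ^ 2) := by
  obtain ⟨R, hR⟩ := exists_lipschitzWith_dualNorm K
  have i1 := (integrable_norm_pow_mul_exp (n := n) 1).const_mul (R : ℝ)
  have hc := hR.continuous
  refine i1.mono' (by fun_prop) (.of_forall fun y => ?_)
  have h0 : dualNorm K 0 = 0 := by
    unfold dualNorm
    rw [Set.image_congr (g := fun _ => (0 : ℝ)) (fun _ _ => inner_zero_left _),
      K.nonempty.image_const, csSup_singleton]
  rw [Real.norm_of_nonneg (mul_nonneg (dualNorm_nonneg hsymm y) (Real.exp_pos _).le), pow_one,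
    ← mul_assoc]
  gcongr
  have := hR.dist_le_mul y 0
  rw [h0, dist_zero_right, dist_zero_right] at this
  exact (le_abs_self _).trans this

theorem meanDualNorm_nonneg (hsymm : ∀ x ∈ K, -x ∈ K) : 0 ≤ meanDualNorm K :=
  integral_nonneg fun _ => dualNorm_nonneg hsymm _

theorem IsTwoConvex.integral_norm_le {α : ℝ} (hK : IsTwoConvex K α) (hα : 0 < α)
    [NeZero n]
    (h0 : (K : Set (EuclideanSpace ℝ (Fin n))) ∈ 𝓝 0) (hsymm : ∀ x ∈ K, -x ∈ K)
    (hvol : volume (K : Set (EuclideanSpace ℝ (Fin n))) = 1) :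
    ∫ x in (K : Set (EuclideanSpace ℝ (Fin n))), ‖x‖ ≤
      √(Real.pi / 4) * (√(2 * Real.pi) / 2) * (meanDualNorm K / √α) := by
  set z := √(2 * Real.pi) with hz
  have hz0 : 0 < z := by positivity
  have hn : (0 : ℝ) < n := Nat.cast_pos.2 (NeZero.pos n)
  have hKm : MeasurableSet (K : Set (EuclideanSpace ℝ (Fin n))) := K.isClosed.measurableSet
  set c := √(Real.pi / (4 * α * n)) with hc
  have hjoint : Integrable (Function.uncurry fun x y : EuclideanSpace ℝ (Fin n) =>
      |inner ℝ y x| * Real.exp (-(1 / 2) * ‖y‖ ^ 2))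
      ((volume.restrict (K : Set (EuclideanSpace ℝ (Fin n)))).prod volume) := by
    have hKint : Integrable (fun x : EuclideanSpace ℝ (Fin n) => ‖x‖)
        (volume.restrict (K : Set (EuclideanSpace ℝ (Fin n)))) :=
      continuous_norm.continuousOn.integrableOn_compact K.isCompact
    refine (hKint.mul_prod (integrable_norm_pow_mul_exp (n := n) 1)).mono'
      (Continuous.aestronglyMeasurable (by fun_prop)) (.of_forall fun p => ?_)
    simp only [Function.uncurry, pow_one]
    rw [Real.norm_of_nonneg (by positivity), ← mul_assoc]
    gcongr
    rw [mul_comm]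
    exact abs_real_inner_le_norm _ _
  have hmain : (∫ x in (K : Set (EuclideanSpace ℝ (Fin n))), ‖x‖) * (2 * z ^ (n - 1)) ≤
      c * (meanDualNorm K * (√n * z ^ n)) := by
    calc _ = ∫ x in (K : Set (EuclideanSpace ℝ (Fin n))), ∫ y : EuclideanSpace ℝ (Fin n),
          |inner ℝ y x| * Real.exp (-(1 / 2) * ‖y‖ ^ 2) := by
          simp_rw [integral_abs_inner_mul_exp]
          rw [integral_mul_const]
      _ = ∫ y : EuclideanSpace ℝ (Fin n), ∫ x in (K : Set (EuclideanSpace ℝ (Fin n))),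
          |inner ℝ y x| * Real.exp (-(1 / 2) * ‖y‖ ^ 2) := integral_integral_swap hjoint
      _ ≤ ∫ y : EuclideanSpace ℝ (Fin n),
          c * (dualNorm K y * Real.exp (-(1 / 2) * ‖y‖ ^ 2)) := by
          refine integral_mono_of_nonneg
            (.of_forall fun y => integral_nonneg fun x => by positivity)
            ((integrable_dualNorm_mul_exp hsymm).const_mul c) (.of_forall fun y => ?_)
          simp only
          rw [integral_mul_const, ← mul_assoc]
          gcongr
          exact hK.integral_abs_inner_le hα (NeZero.pos n) h0 hsymm hvol y
      _ ≤ _ := by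
          rw [integral_const_mul, integral_dualNorm_mul_exp]
          have := meanDualNorm_nonneg hsymm
          gcongr
          exact integral_norm_mul_exp_le
  have hzn : z ^ n = z * z ^ (n - 1) := (mul_pow_sub_one (NeZero.ne n) z).symm
  -- The dimension cancels here.
  have hcn : c * √n = √(Real.pi / 4) / √α := by
    rw [hc, ← Real.sqrt_mul (by positivity), ← Real.sqrt_div (by positivity)]
    congr 1
    field_simp
  rw [hzn] at hmain
  refine le_of_mul_le_mul_right (hmain.trans_eq ?_) (show 0 < 2 * z ^ (n - 1) by positivity)
  calc c * (meanDualNorm K * (√n * (z * z ^ (n - 1))))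
      = (c * √n) * (meanDualNorm K * z * z ^ (n - 1)) := by ring
    _ = _ := by
      rw [hcn]
      ring

end Body

end TwoConvexBody

theorem mainTheorem12 :
    ∃ C : ℝ, 0 < C ∧
      ∀ (n : ℕ), 1 ≤ n →
      ∀ (K : ConvexBody (EuclideanSpace ℝ (Fin n))),
        (interior (K : Set (EuclideanSpace ℝ (Fin n)))).Nonempty →
        (∀ x ∈ K, -x ∈ K) →
      ∀ (α : ℝ), 0 < α →
        TwoConvexBody.IsTwoConvex K α →
        volume (K : Set (EuclideanSpace ℝ (Fin n))) = 1 →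
        ∫ x in (K : Set (EuclideanSpace ℝ (Fin n))), ‖x‖ ≤
          C * (TwoConvexBody.meanDualNorm K / Real.sqrt α) := by
  refine ⟨√(Real.pi / 4) * (√(2 * Real.pi) / 2), by positivity, ?_⟩
  intro n hn K hint hsymm α hα hK hvol
  have : NeZero n := ⟨by omega⟩
  exact hK.integral_norm_le hα (TwoConvexBody.mem_nhds_zero hint hsymm) hsymm hvol
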